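/- Let $k$ be an algebraically closed field of characteristic $p>0$. A *symmetric fusion category* over $k$ is a $k$-linear abelian rigid symmetric monoidal category $\mathcal C$ with $k$-bilinear tensor product, finite-dimensional spaces of morphisms, every object a finite direct sum of simple objects, finitely many isomorphism classes of simple objects, and simple unit object $\mathbf 1$ (so $\operatorname{End}(\mathbf 1)=k$). In a rigid symmetric monoidal category the trace of $f\colon X\to X$ is the composition $$\mathbf 1\xrightarrow{\mathrm{coev}}X\otimes X^*\xrightarrow{f\otimes \mathrm{id}}X\otimes X^*\xrightarrow{c_{X,X^*}}X^*\otimes X\xrightarrow{\mathrm{ev}}\mathbf 1,$$ $\dim(X)$ is the trace of $\mathrm{id}_X$, and a morphism $f\colon X\to Y$ is *negligible* if $f\circ u$ (equivalently $u\circ f$) has trace $0$ for all $u\colon Y\to X$. The *global dimension* of $\mathcal C$ is $\dim(\mathcal C)=\sum_X\dim(X)^2\in k$, where $X$ runs over representatives of the isomorphism classes of simple objects, and $\mathcal C$ is *non-degenerate* if $\dim(\mathcal C)\neq 0$ in $k$. Let $C_p$ be the cyclic group of order $p$, let $\mathcal C_{C_p}$ be the category of objects of $\mathcal C$ with a $C_p$-action,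 and let $\overline{\mathcal C}_{C_p}$ be its quotient by negligible morphisms. Let $\mathrm{Ver}_p$ be the quotient of the category $\mathrm{Rep}_k(C_p)$ of finite-dimensional representations by negligible morphisms. The assignment sending $(X,V)$ to $X$ (with trivial action) tensored with $V\otimes\mathbf 1$ (with the action on $V$) identifies $\overline{\mathcal C}_{C_p}$ with the external tensor product $\mathcal C\boxtimes \mathrm{Ver}_p$. For a fusion subcategory $\mathcal A\subset\mathrm{Ver}_p$ (a full subcategory containing the unit object and closed under tensor products, direct sums and direct summands), $\mathcal C\boxtimes\mathcal A\subset\mathcal C\boxtimes\mathrm{Ver}_p$ consists of the direct summands of the objects $X\boxtimes V$ with $X\in\mathcal C$, $V\in\mathcal A$. The *Frobenius functor* $\mathrm{Fr}\colon\mathcal C\to\overline{\mathcal C}_{C_p}=\mathcal C\boxtimes\mathrm{Ver}_p$ sends $X$ to $X^{\otimes p}$ with $C_p$ acting by cyclic permutations of the factors, and $f$ to the class of $f^{\otimes p}$; it is additive, with $\mathrm{Fr}(\lambda f)=\lambda^p\,\mathrm{Fr}(f)$ for $\lambda\in k$, and becomes $k$-linear when $\mathcal C$ is replaced in the target by its Frobenius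 twist $\mathcal C^{(1)}$. The category $\mathcal C$ is *Frobenius injective* if $\mathrm{Fr}$ is fully faithful, and *of Frobenius type* $\mathcal A$ if $\mathcal A$ is the smallest fusion subcategory of $\mathrm{Ver}_p$ such that $\mathrm{Fr}(X)\in\mathcal C\boxtimes\mathcal A$ for all $X\in\mathcal C$. Let $\mathrm{Vec}\subset\mathrm{Ver}_p$ be the fusion subcategory of finite direct sums of the unit object. **Lemma.** Let $\mathcal C$ be a symmetric fusion category over $k$ which is Frobenius injective and of Frobenius type $\mathrm{Vec}$. Then $\mathcal C$ is non-degenerate. -/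

import Mathlib

universe w v u

open CategoryTheory MonoidalCategory Limits

noncomputable section

namespace SymFusion

attribute [local instance] Abelian.hasFiniteBiproducts

/-! ### Fusion categories, traces and the global dimension -/

section Fusion

variable (k : Type w) [Field k] (C : Type u) [Category.{v} C] [Abelian C] [Linear k C]
  [MonoidalCategory C]

/-- The conditions which make a `k`-linear abelian rigid monoidal category a fusion category:
finite dimensional spaces of morphisms, every object is a finite direct sum of simple objects,
finitely many isomorphism classes of simple objects, and a simple unit object. (Linearity of the
tensor product, rigidity and the symmetry are separate instance arguments below.) -/
class IsFusionCategory : Prop where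
  finite_hom : ∀ X Y : C, Module.Finite k (X ⟶ Y)
  semisimple : ∀ X : C, ∃ (n : ℕ) (S : Fin n → C),
    (∀ i, Simple (S i)) ∧ Nonempty (X ≅ ⨁ S)
  finite_simple : ∃ (n : ℕ) (S : Fin n → C), ∀ X : C, Simple X → ∃ i, Nonempty (X ≅ S i)
  simple_unit : Simple (𝟙_ C)

/-- The set of isomorphism classes of simple objects. -/
def SimpleClass : Type u :=
  _root_.Quotient ((isIsomorphicSetoid C).comap (Subtype.val : {X : C // Simple X} → C))

variable {C} in
/-- A simple object representing a given isomorphism class. -/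
def SimpleClass.rep (s : SimpleClass C) : C := (_root_.Quotient.out s).1

variable {C} in
lemma exists_unitScalar [IsAlgClosed k] [IsFusionCategory k C] (f : 𝟙_ C ⟶ 𝟙_ C) :
    ∃ c : k, c • 𝟙 (𝟙_ C) = f :=
  haveI : Simple (𝟙_ C) := IsFusionCategory.simple_unit k
  haveI : FiniteDimensional k (𝟙_ C ⟶ 𝟙_ C) := IsFusionCategory.finite_hom (k := k) _ _
  endomorphism_simple_eq_smul_id k f

variable {C} in
/-- The scalar by which an endomorphism of the unit object acts: the inverse of the
identification `k = End(𝟙)`. -/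
def unitScalar [IsAlgClosed k] [IsFusionCategory k C] (f : 𝟙_ C ⟶ 𝟙_ C) : k :=
  (exists_unitScalar k f).choose

end Fusion

section Trace

variable {D : Type u} [Category.{v} D] [MonoidalCategory D] [SymmetricCategory D]
  [RightRigidCategory D]

/-- The trace of an endomorphism in a rigid symmetric monoidal category (the trace for the
canonical spherical structure of such a category), an endomorphism of the unit object:
`𝟙 ⟶ X ⊗ X* ⟶ X ⊗ X* ⟶ X* ⊗ X ⟶ 𝟙`. -/
def catTrace {X : D} (f : X ⟶ X) : 𝟙_ D ⟶ 𝟙_ D :=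
  η_ X Xᘁ ≫ f ▷ Xᘁ ≫ (β_ X Xᘁ).hom ≫ ε_ X Xᘁ

end Trace

section GlobalDim

variable (k : Type w) [Field k] [IsAlgClosed k] {C : Type u} [Category.{v} C] [Abelian C]
  [Linear k C] [MonoidalCategory C] [SymmetricCategory C] [RigidCategory C]
  [IsFusionCategory k C]

/-- The dimension `dim X ∈ k` of an object: the trace of its identity. -/
def catDim (X : C) : k := unitScalar k (catTrace (𝟙 X))

variable (C)

/-- The global dimension: the sum of the squares of the dimensions of the simple objects, one for
each of the (finitely many) isomorphism classes. -/
def globalDim : k := ∑ᶠ s : SimpleClass C, catDim k s.rep ^ 2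

/-- A symmetric fusion category is non-degenerate if its global dimension is nonzero in `k`. -/
def IsNondegenerate : Prop := globalDim k C ≠ 0

end GlobalDim

/-! ### Tensor powers and the action of the cyclic group -/

section TensorPower

variable {C : Type u} [Category.{v} C] [MonoidalCategory C]

/-- The tensor power `X ⊗ (X ⊗ (⋯ ⊗ (X ⊗ 𝟙)))`. -/
@[reducible] def tpow (X : C) : ℕ → C
  | 0 => 𝟙_ C
  | n + 1 => X ⊗ tpow X n

/-- The tensor power `f ⊗ ⋯ ⊗ f` of a morphism. -/
def tpowMap {X Y : C} (f : X ⟶ Y) : (n : ℕ) → (tpow X n ⟶ tpow Y n)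
  | 0 => 𝟙 (𝟙_ C)
  | n + 1 => f ⊗ₘ tpowMap f n

/-- The structural identification `X^{⊗ n} ⊗ X = X ⊗ X^{⊗ n}` made of associators and unitors
(the order of the `n + 1` factors is kept). -/
def snoc (X : C) : (n : ℕ) → (tpow X n ⊗ X ⟶ X ⊗ tpow X n)
  | 0 => (λ_ X).hom ≫ (ρ_ X).inv
  | n + 1 => (α_ X (tpow X n) X).hom ≫ X ◁ snoc X n

lemma tpowMap_id (X : C) (n : ℕ) : tpowMap (𝟙 X) n = 𝟙 (tpow X n) := by
  induction n with
  | zero => rfl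
  | succ n ih => simp [tpowMap, ih, tpow]

lemma tpowMap_comp {X Y Z : C} (f : X ⟶ Y) (g : Y ⟶ Z) (n : ℕ) :
    tpowMap (f ≫ g) n = tpowMap f n ≫ tpowMap g n := by
  induction n with
  | zero => simp [tpowMap]
  | succ n ih => simp [tpowMap, ih]

lemma snoc_naturality {X Y : C} (f : X ⟶ Y) (n : ℕ) :
    (tpowMap f n ⊗ₘ f) ≫ snoc Y n = snoc X n ≫ (f ⊗ₘ tpowMap f n) := by
  induction n with
  | zero => simp [tpowMap, snoc, tpow, MonoidalCategory.tensorHom_def]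
  | succ n ih =>
    simp only [snoc, tpowMap]
    rw [associator_naturality_assoc, Category.assoc, tensorHom_comp_whiskerLeft, ih,
      whiskerLeft_comp_tensorHom]

/-- Auxiliary: the structural identification `X^{⊗ j} ⊗ X^{⊗ k} = X^{⊗ n}` for `n = k + j`. -/
def concat (X : C) : (j k n : ℕ) → k + j = n → (tpow X j ⊗ tpow X k ⟶ tpow X n)
  | 0, k, n, h => (λ_ (tpow X k)).hom ≫ eqToHom (by rw [← h]; rfl)
  | j + 1, k, n + 1, h =>
      (α_ X (tpow X j) (tpow X k)).hom ≫ X ◁ concat X j k n (by omega)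
  | _ + 1, _, 0, h => absurd h (by omega)

lemma concat_zero_right (X : C) (n : ℕ) :
    concat X n 0 n (by omega) = (ρ_ (tpow X n)).hom := by
  induction n with
  | zero => simp [concat, tpow, unitors_equal]
  | succ n ih => simp [concat, ih, tpow]

lemma snoc_concat (X : C) (j k n : ℕ) (h : k + j = n) :
    concat X j k n h ▷ X ≫ snoc X n =
      (α_ _ _ _).hom ≫ tpow X j ◁ snoc X k ≫ concat X j (k + 1) (n + 1) (by omega) := by
  induction j generalizing n with
  | zero =>
    obtain rfl : k = n := by omega
    simp [concat, tpow]
  | succ j ih =>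
    obtain _ | n := n
    · omega
    simp only [concat, snoc, comp_whiskerRight, Category.assoc, whisker_assoc,
      Iso.inv_hom_id_assoc]
    rw [← whiskerLeft_comp, ih n (by omega)]
    simp [tpow]

lemma concat_snoc (X : C) (j k n : ℕ) (h : k + j = n) :
    snoc X j ▷ tpow X k ≫ concat X (j + 1) k (n + 1) (by omega) =
      (α_ _ _ _).hom ≫ concat X j (k + 1) (n + 1) (by omega) := by
  induction j generalizing n with
  | zero =>
    obtain rfl : k = n := by omega
    simp [concat, snoc, tpow]
  | succ j ih =>
    obtain _ | n := n
    · omega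
    have := ih n (by omega)
    rw [concat] at this
    rw [concat, concat, concat]
    simp only [snoc, comp_whiskerRight, Category.assoc, whisker_assoc,
      Iso.inv_hom_id_assoc]
    rw [← whiskerLeft_comp, this]
    simp [tpow]

end TensorPower

section Cyclic

variable {C : Type u} [Category.{v} C] [MonoidalCategory C] [SymmetricCategory C]

/-- The action of the `n`-cycle on `X^{⊗ n}`: the symmetry moves the first factor past all the
others. -/
def cyc (X : C) : (n : ℕ) → End (tpow X n)
  | 0 => 𝟙 (𝟙_ C)
  | n + 1 => (β_ X (tpow X n)).hom ≫ snoc X n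

lemma cyc_naturality {X Y : C} (f : X ⟶ Y) (n : ℕ) :
    tpowMap f n ≫ cyc Y n = cyc X n ≫ tpowMap f n := by
  cases n with
  | zero => simp [tpowMap, cyc]
  | succ n =>
    simp only [cyc, tpowMap]
    rw [Category.assoc, ← snoc_naturality, BraidedCategory.braiding_naturality_assoc]

lemma braiding_rotate (X A B : C) :
    (α_ X A B).hom ≫ (β_ X (A ⊗ B)).hom ≫ (α_ A B X).hom ≫ (β_ A (B ⊗ X)).hom ≫
      (α_ B X A).hom = (β_ (X ⊗ A) B).hom := by
  have h := congrArg (fun f => f ≫ B ◁ (β_ A X).hom) (BraidedCategory.yang_baxter X A B)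
  simp only [Category.assoc, ← whiskerLeft_comp, SymmetricCategory.symmetry, whiskerLeft_id,
    Category.comp_id] at h
  simp [BraidedCategory.braiding_tensor_right_hom, BraidedCategory.braiding_tensor_left_hom,
    ← h]

lemma concat_cyc_pow (X : C) (j k n : ℕ) (h : k + j = n) :
    concat X j k n h ≫ (cyc X n ^ j : End (tpow X n)) =
      (β_ _ _).hom ≫ concat X k j n (by omega) := by
  induction j generalizing k n with
  | zero =>
    obtain rfl : k = n := by omega
    simp [concat, concat_zero_right, tpow, End.one_def]
  | succ j ih =>
    obtain _ | n := n
    · omega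
    rw [pow_succ, End.mul_def]
    have h2 := ih (k + 1) (n + 1) (by omega)
    generalize (cyc X (n + 1) ^ j : End (tpow X (n + 1))) = z at h2 ⊢
    simp only [concat, cyc, Category.assoc]
    rw [BraidedCategory.braiding_naturality_right_assoc,
      reassoc_of% snoc_concat X j k n (by omega)]
    rw [h2, BraidedCategory.braiding_naturality_right_assoc, concat_snoc X k j n (by omega),
      ← braiding_rotate]
    simp only [Category.assoc]

lemma cyc_pow_self (X : C) (n : ℕ) : cyc X n ^ n = 1 := by
  have h := concat_cyc_pow X n 0 n (by omega)
  rw [concat_zero_right] at h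
  have h' : (β_ (tpow X n) (tpow X 0)).hom ≫ concat X 0 n n (by omega) =
      (ρ_ (tpow X n)).hom := by simp [concat, tpow]
  rw [h'] at h
  exact (cancel_epi (ρ_ (tpow X n)).hom).1 (h.trans (Category.comp_id _).symm)

lemma cyc_pow_naturality {X Y : C} (f : X ⟶ Y) (n m : ℕ) :
    (cyc X n ^ m : End (tpow X n)) ≫ tpowMap f n =
      tpowMap f n ≫ (cyc Y n ^ m : End (tpow Y n)) := by
  induction m with
  | zero => simp [End.one_def]
  | succ m ih =>
    rw [pow_succ, pow_succ, End.mul_def, End.mul_def, Category.assoc, ih,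
      ← Category.assoc, ← cyc_naturality, Category.assoc]

/-- The cyclic group of order `p`, written multiplicatively. -/
abbrev Cp (p : ℕ) : Type := Multiplicative (ZMod p)

/-- The object `X^{⊗ p}` with `C_p` acting through the cyclic permutations of the factors, as an
object of the equivariantization of `C` for the trivial action of `C_p` on `C`, which is the
category `Action C (Cp p)` of objects of `C` with an action of `C_p`. -/
def tpowAction (p : ℕ) [NeZero p] (X : C) : Action C (Cp p) where
  V := tpow X p
  ρ :=
    { toFun := fun g => cyc X p ^ (Multiplicative.toAdd g).val
      map_one' := by simp
      map_mul' := fun g h => by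
        rw [← pow_add, toAdd_mul, ZMod.val_add, ← pow_eq_pow_mod _ (cyc_pow_self X p)] }

variable (C) in
/-- The (non-additive) functor `X ↦ X^{⊗ p}` from `C` to the objects of `C` with `C_p`-action. -/
def tpowFunctor (p : ℕ) [NeZero p] : C ⥤ Action C (Cp p) where
  obj X := tpowAction p X
  map f := { hom := tpowMap f p, comm := fun _ => cyc_pow_naturality f p _ }
  map_id X := by ext; exact tpowMap_id X p
  map_comp f g := by ext; exact tpowMap_comp f g p

end Cyclic

/-! ### Quotients by negligible morphisms -/

section Negligible

variable (D : Type u) [Category.{v} D] [MonoidalCategory D] [SymmetricCategory D]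
  [RightRigidCategory D] [Preadditive D]

variable {D} in
/-- A morphism `f : X ⟶ Y` is negligible if the trace of its composition with any morphism
`u : Y ⟶ X` vanishes. -/
def IsNegligible {X Y : D} (f : X ⟶ Y) : Prop := ∀ u : Y ⟶ X, catTrace (f ≫ u) = 0

/-- Two morphisms are identified in the quotient if their difference is negligible. -/
def negRel : HomRel D := fun _ _ f g => IsNegligible (f - g)

/-- The quotient of `D` by the negligible morphisms: it has the same objects, and morphisms
are taken modulo negligible ones. -/
abbrev NegQuot := CategoryTheory.Quotient (negRel D)

/-- The quotient functor. -/
abbrev toNegQuot : D ⥤ NegQuot D := CategoryTheory.Quotient.functor (negRel D)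

variable {D} in
/-- A full subcategory of the quotient of `D` by the negligible morphisms (given as a property of
objects) is a fusion subcategory if it contains the unit and is closed under tensor products,
direct sums and direct summands. The unit, the tensor products and the direct sums of the quotient
category are the images of those of `D`. -/
structure IsFusionSubcategory [HasBinaryBiproducts D] (A : ObjectProperty (NegQuot D)) :
    Prop where
  unit : A ((toNegQuot D).obj (𝟙_ D))
  tensor : ∀ X Y : D, A ((toNegQuot D).obj X) → A ((toNegQuot D).obj Y) →
    A ((toNegQuot D).obj (X ⊗ Y))
  biprod : ∀ X Y : D, A ((toNegQuot D).obj X) → A ((toNegQuot D).obj Y) →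
    A ((toNegQuot D).obj (X ⊞ Y))
  summand : ∀ X Y : NegQuot D, Nonempty (Retract X Y) → A Y → A X

end Negligible

/-! ### The universal Verlinde category -/

section Verlinde

variable (k : Type w) [Field k] (p : ℕ)

instance (G : Type) [Group G] : HasFiniteBiproducts (FDRep k G) :=
  HasFiniteBiproducts.of_hasFiniteProducts

/-- The universal Verlinde category `Ver_p`: the quotient of the category of finite dimensional
representations of `C_p` over `k` by the negligible morphisms. -/
abbrev Ver := NegQuot (FDRep k (Cp p))

/-- The subcategory `Vec` of `Ver_p`: the objects isomorphic to finite direct sums of copies of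
the unit object. -/
def vecSub : ObjectProperty (Ver k p) := fun Z =>
  ∃ n : ℕ, Nonempty (Z ≅ (toNegQuot (FDRep k (Cp p))).obj (⨁ fun _ : Fin n => 𝟙_ _))

end Verlinde

/-! ### The Frobenius functor -/

section Frobenius

variable (k : Type w) [Field k] (p : ℕ) [NeZero p]
  (C : Type u) [Category.{v} C] [Abelian C] [Linear k C]
  [MonoidalCategory C] [SymmetricCategory C] [MonoidalPreadditive C] [RigidCategory C]

/-- The functor `V ↦ V ⊗ 𝟙` from finite dimensional vector spaces to `C`: a space with a basis of
`d` elements goes to the sum of `d` copies of `𝟙`, and a linear map goes to its matrix. -/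
def vecFunctor : FGModuleCat.{w} k ⥤ C where
  obj V := ⨁ fun _ : Fin (Module.finrank k V) => 𝟙_ C
  map {V W} f := biproduct.matrix fun i j =>
    (LinearMap.toMatrix (Module.finBasis k V) (Module.finBasis k W) f.hom.hom j i) • 𝟙 (𝟙_ C)
  map_id V := by
    ext i j
    by_cases h : i = j
    · subst h; simp
    · simp [Matrix.one_apply, h, Ne.symm h]
  map_comp {U V W} f g := by
    ext i j
    simp [LinearMap.toMatrix_comp _ (Module.finBasis k V), Matrix.mul_apply, Finset.sum_smul,
      biproduct.lift_desc, smul_smul, mul_comm]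

/-- The quotient of the category of objects of `C` with a `C_p`-action by the negligible morphisms.
For a semisimple `C` this is the external tensor product `C ⊠ Ver_p`, and it is taken here as the
model of the latter. -/
abbrev BoxVer := NegQuot (Action C (Cp p))

variable {C} in
/-- The object `X ⊠ V` of `C ⊠ Ver_p`: the tensor product of `X` with the trivial action and of
`V ⊗ 𝟙`, on which `C_p` acts through `V`. -/
def box (X : C) (V : Ver k p) : BoxVer p C :=
  (toNegQuot (Action C (Cp p))).obj
    (Action.trivial (Cp p) X ⊗ ((vecFunctor k C).mapAction (Cp p)).obj V.as)

/-- The subcategory `C ⊠ A` of `C ⊠ Ver_p` for a subcategory `A` of `Ver_p`: the objects which are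
direct summands of an object `X ⊠ V` with `V` in `A` (an external tensor product is the idempotent
completion of the category of the objects `X ⊠ V`). -/
def boxSub (A : ObjectProperty (Ver k p)) : ObjectProperty (BoxVer p C) := fun Z =>
  ∃ (X : C) (V : Ver k p), A V ∧ Nonempty (Retract Z (box k p X V))

/-- The Frobenius functor `Fr : C ⥤ C ⊠ Ver_p`, the composition of `X ↦ X^{⊗ p}` (with its action
of `C_p`) with the quotient by the negligible morphisms. It is additive and satisfies
`Fr (c • f) = c ^ p • Fr f`; passing from `C` to its Frobenius twist in the target makes it
`k`-linear, and changes neither the category nor the functor, but only the scalar multiplication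
on the morphisms of the target. -/
def frobeniusFunctor : C ⥤ BoxVer p C :=
  tpowFunctor C p ⋙ toNegQuot (Action C (Cp p))

/-- `C` is Frobenius injective if the Frobenius functor is fully faithful. -/
def IsFrobeniusInjective : Prop :=
  (frobeniusFunctor p C).Full ∧ (frobeniusFunctor p C).Faithful

/-- `C` is of Frobenius type `A` if `A` is the smallest fusion subcategory of `Ver_p` such that
the image of the Frobenius functor is contained in `C ⊠ A`. -/
def IsOfFrobeniusType (A : ObjectProperty (Ver k p)) : Prop :=
  IsLeast {B : ObjectProperty (Ver k p) |
    IsFusionSubcategory B ∧ ∀ X : C, boxSub k p C B ((frobeniusFunctor p C).obj X)} A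

end Frobenius

end SymFusion

end

/-!
The global dimension satisfies `dim(C) ^ (p - 1) = 1` in `k`, hence is nonzero. Write `[Z : 𝟙]` for
the multiplicity of the unit object in `Z`, taken in `k`, extended linearly to formal `k`-linear
combinations of tensor products of simple objects. These combinations are encoded as polynomials in
the classes of simple objects, which is possible because `[Z : 𝟙]` is invariant under permutations
of tensor factors; the resulting functional is `unitMultiplicity`.

Let `ω = ∑ dim(S) S` be the regular element. Since `[S ⊗ W : 𝟙]` is the multiplicity of `S` in the
dual of `W`, one has `[ω ⊗ W : 𝟙] = dim W` for every `W`
(`sum_catDim_mul_finrank_hom_unit`), and iterating this gives `[ω ^ p : 𝟙] = dim(C) ^ (p - 1)`. On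
the other hand `ω ^ p = ∑ dim(S) ^ p S ^ p` in characteristic `p`, so it is enough to know that
`[S^{⊗ p} : 𝟙] = 0` in `k` for every simple `S` other than `𝟙` (`finrank_hom_unit_tpow`).

For this vanishing, let `Z` be `S^{⊗ p}` with the cyclic action, and let `e` be the projection of
`Z` to its largest summand which is a sum of copies of `𝟙`, so that `[Z : 𝟙]` is the trace of `e`.
As the Frobenius functor is full and there are no nonzero morphisms `𝟙 ⟶ S`, all equivariant morphisms
`𝟙 ⟶ Z` are negligible (`isNegligible_of_full`). As `C` is of Frobenius type `Vec`, the identity of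
`Z` is, up to negligible morphisms, a composition `Z ⟶ B ⟶ Z` with a trivial action on `B`. This
does not change the trace of `e`; but `e` restricted to such a composition is a sum of compositions
`Z ⟶ 𝟙 ⟶ Z` of equivariant morphisms, whose traces vanish (`finrank_hom_unit_eq_zero`).
-/

noncomputable section

namespace SymFusion

attribute [local instance] Abelian.hasFiniteBiproducts

set_option linter.unusedSectionVars false

/-! ### Traces in rigid symmetric monoidal categories -/

section TraceProperties

variable {D : Type u} [Category.{v} D] [MonoidalCategory D] [SymmetricCategory D]

/-- Cyclicity of the trace, with the traces on both sides computed by arbitrary duals: `g` is moved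
around the loop through its transpose. For `g = 𝟙` this says that the trace does not depend on the
choice of the dual. -/
lemma exactPairing_trace_comp_comm {X X' Y Y' : D} [ExactPairing X X'] [ExactPairing Y Y']
    (f : X ⟶ Y) (g : Y ⟶ X) :
    η_ X X' ≫ (f ≫ g) ▷ X' ≫ (β_ X X').hom ≫ ε_ X X' =
      η_ Y Y' ≫ (g ≫ f) ▷ Y' ≫ (β_ Y Y').hom ≫ ε_ Y Y' := by
  let : HasRightDual X := ⟨X'⟩
  let : HasRightDual Y := ⟨Y'⟩
  change η_ X Xᘁ ≫ (f ≫ g) ▷ Xᘁ ≫ (β_ X Xᘁ).hom ≫ ε_ X Xᘁ =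
      η_ Y Yᘁ ≫ (g ≫ f) ▷ Yᘁ ≫ (β_ Y Yᘁ).hom ≫ ε_ Y Yᘁ
  rw [comp_whiskerRight, Category.assoc, BraidedCategory.braiding_naturality_left_assoc,
    ← rightAdjointMate_comp_evaluation, ← BraidedCategory.braiding_naturality_right_assoc,
    ← whisker_exchange_assoc]
  rw [← Category.assoc (η_ X Xᘁ), coevaluation_comp_rightAdjointMate]
  simp

lemma catTrace_eq_of_exactPairing [RightRigidCategory D] {X Y : D} (h : ExactPairing X Y)
    (f : X ⟶ X) :
    catTrace f = η_ X Y ≫ f ▷ Y ≫ (β_ X Y).hom ≫ ε_ X Y := by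
  have := exactPairing_trace_comp_comm (X' := Xᘁ) (Y' := Y) f (𝟙 X)
  rwa [Category.comp_id, Category.id_comp] at this

lemma catTrace_comp_comm [RightRigidCategory D] {X Y : D} (f : X ⟶ Y) (g : Y ⟶ X) :
    catTrace (f ≫ g) = catTrace (g ≫ f) :=
  exactPairing_trace_comp_comm f g

lemma catTrace_unit [RightRigidCategory D] (f : 𝟙_ D ⟶ 𝟙_ D) : catTrace f = f := by
  rw [catTrace_eq_of_exactPairing exactPairingUnit]
  change (ρ_ (𝟙_ D)).inv ≫ f ▷ (𝟙_ D) ≫ (β_ (𝟙_ D) (𝟙_ D)).hom ≫ (ρ_ (𝟙_ D)).hom = f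
  simp [unitors_inv_equal]

lemma catTrace_comp_unit [RightRigidCategory D] {X : D} (f : X ⟶ 𝟙_ D) (g : 𝟙_ D ⟶ X) :
    catTrace (f ≫ g) = g ≫ f := by
  rw [catTrace_comp_comm, catTrace_unit]

lemma catTrace_id_congr [RightRigidCategory D] {X Y : D} (i : X ≅ Y) :
    catTrace (𝟙 X) = catTrace (𝟙 Y) := by
  rw [← i.hom_inv_id, catTrace_comp_comm, i.inv_hom_id]

lemma catTrace_id_eq_of_exactPairing [RightRigidCategory D] (X Y : D) [ExactPairing X Y] :
    catTrace (𝟙 X) = catTrace (𝟙 Y) := by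
  rw [catTrace_eq_of_exactPairing (BraidedCategory.exactPairing_swap X Y) (𝟙 Y),
    catTrace_eq_of_exactPairing ‹ExactPairing X Y› (𝟙 X)]
  change _ = (η_ X Y ≫ (β_ Y X).inv) ≫ _ ≫ _ ≫ (β_ X Y).hom ≫ ε_ X Y
  simp [SymmetricCategory.braiding_swap_eq_inv_braiding Y X]

/-- The image of an exact pairing under a strong monoidal functor. -/
@[reducible]
def exactPairingMap {E : Type*} [Category* E] [MonoidalCategory E] (F : D ⥤ E) [F.Monoidal]
    (X Y : D) [ExactPairing X Y] : ExactPairing (F.obj X) (F.obj Y) where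
  coevaluation' := Functor.LaxMonoidal.ε F ≫ F.map (η_ X Y) ≫ Functor.OplaxMonoidal.δ F X Y
  evaluation' := Functor.LaxMonoidal.μ F Y X ≫ F.map (ε_ X Y) ≫ Functor.OplaxMonoidal.η F
  coevaluation_evaluation' := by
    have h := congrArg F.map (ExactPairing.coevaluation_evaluation X Y)
    rw [F.map_comp, F.map_comp, F.map_comp, Functor.Monoidal.map_associator_inv,
      Functor.Monoidal.map_whiskerLeft, Functor.Monoidal.map_whiskerRight,
      Functor.Monoidal.map_rightUnitor, Functor.Monoidal.map_leftUnitor_inv] at h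
    rw [← cancel_epi (Functor.OplaxMonoidal.δ F Y (𝟙_ D) ≫
      F.obj Y ◁ Functor.OplaxMonoidal.η F),
      ← cancel_mono (Functor.LaxMonoidal.ε F ▷ F.obj Y ≫ Functor.LaxMonoidal.μ F (𝟙_ D) Y)]
    simp only [Category.assoc] at h ⊢
    rw [← h]
    simp
  evaluation_coevaluation' := by
    have h := congrArg F.map (ExactPairing.evaluation_coevaluation X Y)
    rw [F.map_comp, F.map_comp, F.map_comp, Functor.Monoidal.map_associator,
      Functor.Monoidal.map_whiskerLeft, Functor.Monoidal.map_whiskerRight,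
      Functor.Monoidal.map_rightUnitor_inv, Functor.Monoidal.map_leftUnitor] at h
    rw [← cancel_epi (Functor.OplaxMonoidal.δ F (𝟙_ D) X ≫
      Functor.OplaxMonoidal.η F ▷ F.obj X),
      ← cancel_mono (F.obj X ◁ Functor.LaxMonoidal.ε F ≫ Functor.LaxMonoidal.μ F X (𝟙_ D))]
    simp only [Category.assoc] at h ⊢
    rw [← h]
    simp

/-- The tensor product functor of a symmetric category is compatible with the symmetries. -/
lemma tensorμ_braiding (X A Y B : D) :
    tensorμ X A Y B ≫ (β_ (X ⊗ Y) (A ⊗ B)).hom =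
      ((β_ X A).hom ⊗ₘ (β_ Y B).hom) ≫ tensorμ A X B Y := by
  simp [tensorμ, SymmetricCategory.braiding_swap_eq_inv_braiding Y A,
    MonoidalCategory.tensorHom_def]

lemma tensorδ_eq_tensorμ (X Y A B : D) : tensorδ X Y A B = tensorμ X A Y B := by
  simp [tensorμ, tensorδ, SymmetricCategory.braiding_swap_eq_inv_braiding Y A]

/-- Exact pairings in a product category are formed componentwise. -/
@[reducible]
def exactPairingProd (X Y A B : D) [ExactPairing X A] [ExactPairing Y B] :
    ExactPairing ((X, Y) : D × D) (A, B) where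
  coevaluation' := Prod.mkHom (η_ X A) (η_ Y B)
  evaluation' := Prod.mkHom (ε_ X A) (ε_ Y B)
  coevaluation_evaluation' := Prod.ext
    (ExactPairing.coevaluation_evaluation X A) (ExactPairing.coevaluation_evaluation Y B)
  evaluation_coevaluation' := Prod.ext
    (ExactPairing.evaluation_coevaluation X A) (ExactPairing.evaluation_coevaluation Y B)

/-- Multiplicativity of the dimension: the tensor product functor `D × D ⥤ D` is a symmetric
monoidal functor, so it takes duals to duals and preserves traces. -/
lemma catTrace_id_tensor [RightRigidCategory D] (X Y : D) :
    catTrace (𝟙 (X ⊗ Y)) =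
      (λ_ (𝟙_ D)).inv ≫ (catTrace (𝟙 X) ⊗ₘ catTrace (𝟙 Y)) ≫ (λ_ (𝟙_ D)).hom := by
  let := exactPairingProd X Y Xᘁ Yᘁ
  rw [catTrace_eq_of_exactPairing (exactPairingMap (tensor D) (X, Y) (Xᘁ, Yᘁ))]
  change ((λ_ (𝟙_ D)).inv ≫ (η_ X Xᘁ ⊗ₘ η_ Y Yᘁ) ≫ tensorδ X Y Xᘁ Yᘁ) ≫
    𝟙 (X ⊗ Y) ▷ (Xᘁ ⊗ Yᘁ) ≫ (β_ (X ⊗ Y) (Xᘁ ⊗ Yᘁ)).hom ≫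
      tensorμ Xᘁ Yᘁ X Y ≫ (ε_ X Xᘁ ⊗ₘ ε_ Y Yᘁ) ≫ (λ_ (𝟙_ D)).hom = _
  simp only [id_whiskerRight, Category.id_comp, Category.assoc, tensorδ_eq_tensorμ]
  rw [reassoc_of% tensorμ_braiding X Xᘁ Y Yᘁ, ← tensorδ_eq_tensorμ, tensorδ_tensorμ_assoc]
  simp [catTrace]

end TraceProperties

section ActionTrace

variable {D : Type u} [Category.{v} D] [MonoidalCategory D] [SymmetricCategory D]
  [RightRigidCategory D] {G : Type*} [Group G]

/-- Traces of equivariant endomorphisms are computed after forgetting the action. -/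
lemma hom_catTrace {M : Action D G} (f : M ⟶ M) : (catTrace f).hom = catTrace f.hom := by
  let e := exactPairingMap (Action.forget D G) M Mᘁ
  have h₁ : e.coevaluation' = (η_ M Mᘁ).hom := (Category.id_comp _).trans (Category.comp_id _)
  have h₂ : e.evaluation' = (ε_ M Mᘁ).hom := (Category.id_comp _).trans (Category.comp_id _)
  refine Eq.trans ?_ (catTrace_eq_of_exactPairing e f.hom).symm
  change _ = e.coevaluation' ≫ f.hom ▷ Mᘁ.V ≫ (β_ M.V Mᘁ.V).hom ≫ e.evaluation'
  rw [h₁, h₂]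
  rfl

end ActionTrace

section Additive

variable {D : Type u} [Category.{v} D] [MonoidalCategory D] [SymmetricCategory D]
  [RightRigidCategory D] [Preadditive D] [MonoidalPreadditive D]

lemma catTrace_add {X : D} (f g : X ⟶ X) : catTrace (f + g) = catTrace f + catTrace g := by
  simp [catTrace, MonoidalPreadditive.add_whiskerRight]

variable (D) in
/-- The trace as an additive map. -/
def catTraceHom (X : D) : (X ⟶ X) →+ (𝟙_ D ⟶ 𝟙_ D) where
  toFun := catTrace
  map_zero' := by simp [catTrace]
  map_add' := catTrace_add

lemma catTrace_zero {X : D} : catTrace (0 : X ⟶ X) = 0 := (catTraceHom D X).map_zero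

lemma catTrace_neg {X : D} (f : X ⟶ X) : catTrace (-f) = -catTrace f :=
  (catTraceHom D X).map_neg f

lemma catTrace_sub {X : D} (f g : X ⟶ X) : catTrace (f - g) = catTrace f - catTrace g :=
  (catTraceHom D X).map_sub f g

lemma catTrace_sum {ι : Type*} (s : Finset ι) {X : D} (f : ι → (X ⟶ X)) :
    catTrace (∑ i ∈ s, f i) = ∑ i ∈ s, catTrace (f i) :=
  map_sum (catTraceHom D X) f s

lemma catTrace_smul {k : Type*} [Field k] [Linear k D] [MonoidalLinear k D] {X : D} (c : k)
    (f : X ⟶ X) : catTrace (c • f) = c • catTrace f := by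
  simp [catTrace, MonoidalLinear.smul_whiskerRight]

instance negRel_congruence : Congruence (negRel D) where
  equivalence :=
    { refl := fun f u => by simp [catTrace_zero]
      symm := fun {f g} h u => by
        rw [← neg_sub, Preadditive.neg_comp, catTrace_neg, h u, neg_zero]
      trans := fun {f g h} h₁ h₂ u => by
        rw [← sub_add_sub_cancel f g h, Preadditive.add_comp, catTrace_add, h₁ u, h₂ u,
          add_zero] }
  comp_left {_ _ _} f {g g'} h u := by
    rw [← Preadditive.comp_sub, Category.assoc, catTrace_comp_comm, Category.assoc]
    exact h _
  comp_right {_ _ _ _ _} g h u := by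
    rw [← Preadditive.sub_comp, Category.assoc]
    exact h _

lemma toNegQuot_map_eq_iff {X Y : D} (f g : X ⟶ Y) :
    (toNegQuot D).map f = (toNegQuot D).map g ↔ IsNegligible (f - g) :=
  Quotient.functor_map_eq_iff (negRel D) f g

end Additive

/-! ### Dimensions and multiplicities in fusion categories -/

section HomSpaces

variable (k : Type*) [Field k] {C : Type u} [Category.{v} C] [Preadditive C] [Linear k C]

lemma finrank_hom_congr {X X' Y Y' : C} (i : X ≅ X') (j : Y ≅ Y') :
    Module.finrank k (X ⟶ Y) = Module.finrank k (X' ⟶ Y') :=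
  (Linear.homCongr k i j).finrank_eq

lemma finrank_hom_biproduct_left [HasFiniteBiproducts C]
    [∀ X Y : C, Module.Finite k (X ⟶ Y)] {n : ℕ} (S : Fin n → C) (Y : C) :
    Module.finrank k ((⨁ S) ⟶ Y) = ∑ i, Module.finrank k (S i ⟶ Y) := by
  rw [← Module.finrank_pi_fintype]
  exact LinearEquiv.finrank_eq
    { toFun := fun f i => biproduct.ι S i ≫ f
      invFun := fun f => biproduct.desc f
      map_add' := fun f g => by ext; simp
      map_smul' := fun c f => by ext; simp
      left_inv := fun f => by ext; simp
      right_inv := fun f => by ext; simp }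

lemma finrank_hom_biproduct_right [HasFiniteBiproducts C]
    [∀ X Y : C, Module.Finite k (X ⟶ Y)] {n : ℕ} (S : Fin n → C) (Y : C) :
    Module.finrank k (Y ⟶ ⨁ S) = ∑ i, Module.finrank k (Y ⟶ S i) := by
  rw [← Module.finrank_pi_fintype]
  exact LinearEquiv.finrank_eq
    { toFun := fun f i => f ≫ biproduct.π S i
      invFun := fun f => biproduct.lift f
      map_add' := fun f g => by ext; simp
      map_smul' := fun c f => by ext; simp
      left_inv := fun f => by ext; simp
      right_inv := fun f => by ext; simp }

lemma finrank_hom_tensor_right [MonoidalCategory C] [MonoidalPreadditive C] [MonoidalLinear k C]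
    (X Y Y' Z : C) [ExactPairing Y Y'] :
    Module.finrank k (X ⊗ Y ⟶ Z) = Module.finrank k (X ⟶ Z ⊗ Y') :=
  LinearEquiv.finrank_eq
    { tensorRightHomEquiv X Y Y' Z with
      map_add' := fun f g => by
        simp [tensorRightHomEquiv, MonoidalPreadditive.add_whiskerRight]
      map_smul' := fun c f => by
        simp [tensorRightHomEquiv, MonoidalLinear.smul_whiskerRight] }

end HomSpaces

section UnitProjection

variable {C : Type u} [Category.{v} C] [Preadditive C] [MonoidalCategory C]

/-- The projection of an object to its largest direct summand which is a sum of copies of the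
unit object: an endomorphism which factors through a sum of copies of `𝟙` and does nothing to the
morphisms from and to `𝟙`. -/
structure IsUnitProjection {A : C} (e : A ⟶ A) : Prop where
  comp_eq : ∀ v : 𝟙_ C ⟶ A, v ≫ e = v
  eq_comp : ∀ φ : A ⟶ 𝟙_ C, e ≫ φ = φ
  exists_eq_sum : ∃ (n : ℕ) (ι : Fin n → (𝟙_ C ⟶ A)) (π : Fin n → (A ⟶ 𝟙_ C)),
    e = ∑ j, π j ≫ ι j

/-- Unit projections commute with all morphisms; in particular they are equivariant for any group
acting on the object. -/
lemma IsUnitProjection.naturality {A B : C} {e : A ⟶ A} {e' : B ⟶ B} (he : IsUnitProjection e)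
    (he' : IsUnitProjection e') (f : A ⟶ B) : e ≫ f = f ≫ e' := by
  have h₁ : e ≫ f = e ≫ f ≫ e' := by
    obtain ⟨n, ι, π, h⟩ := he.exists_eq_sum
    rw [h, Preadditive.sum_comp, Preadditive.sum_comp]
    refine Finset.sum_congr rfl fun j _ => ?_
    rw [Category.assoc, Category.assoc, ← Category.assoc (ι j), he'.comp_eq]
  have h₂ : f ≫ e' = e ≫ f ≫ e' := by
    obtain ⟨n, ι, π, h⟩ := he'.exists_eq_sum
    rw [h, Preadditive.comp_sum, Preadditive.comp_sum]
    refine Finset.sum_congr rfl fun j _ => ?_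
    rw [← Category.assoc f, ← Category.assoc e, he.eq_comp]
  rw [h₁, ← h₂]

end UnitProjection

section SimpleClasses

lemma finite_simpleClass (k : Type*) [Field k] (C : Type u) [Category.{v} C] [Abelian C]
    [Linear k C] [MonoidalCategory C] [IsFusionCategory k C] : Finite (SimpleClass C) := by
  obtain ⟨n, S, hS⟩ := IsFusionCategory.finite_simple (k := k) (C := C)
  have hrep : ∀ s : SimpleClass C, ∃ i, Nonempty (s.rep ≅ S i) := fun s => hS _ (Quotient.out s).2
  choose φ hφ using hrep
  refine Finite.of_injective φ fun s t h => ?_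
  obtain ⟨a⟩ := hφ s
  obtain ⟨b⟩ := hφ t
  rw [← _root_.Quotient.out_eq s, ← _root_.Quotient.out_eq t]
  exact _root_.Quotient.sound ⟨a ≪≫ eqToIso (congrArg S h) ≪≫ b.symm⟩

variable {C : Type u} [Category.{v} C] [Abelian C]

instance (s : SimpleClass C) : Simple s.rep := (_root_.Quotient.out s).2

/-- The isomorphism class of a simple object. -/
def simpleClass (X : C) [h : Simple X] : SimpleClass C := _root_.Quotient.mk _ ⟨X, h⟩

lemma simpleClass_eq_iff (X : C) [h : Simple X] (s : SimpleClass C) :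
    simpleClass X = s ↔ Nonempty (X ≅ s.rep) := by
  refine ⟨fun h => ?_, fun h => ?_⟩
  · subst h
    exact _root_.Quotient.exact (_root_.Quotient.out_eq (simpleClass X)).symm
  · rw [← _root_.Quotient.out_eq s]
    exact _root_.Quotient.sound h

end SimpleClasses

section FusionDim

variable (k : Type w) [Field k] [IsAlgClosed k] {C : Type u} [Category.{v} C] [Abelian C]
  [Linear k C] [MonoidalCategory C] [IsFusionCategory k C]

lemma unitScalar_smul_id (f : 𝟙_ C ⟶ 𝟙_ C) : unitScalar k f • 𝟙 (𝟙_ C) = f :=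
  (exists_unitScalar k f).choose_spec

lemma unitScalar_eq {f : 𝟙_ C ⟶ 𝟙_ C} {c : k} (h : c • 𝟙 (𝟙_ C) = f) : unitScalar k f = c :=
  have : Simple (𝟙_ C) := IsFusionCategory.simple_unit k
  smul_left_injective k (id_nonzero (𝟙_ C)) ((unitScalar_smul_id k f).trans h.symm)

variable (C) in
/-- The identification of the endomorphisms of the unit object with scalars, as a linear map. -/
def unitScalarHom : (𝟙_ C ⟶ 𝟙_ C) →ₗ[k] k where
  toFun := unitScalar k
  map_add' f g := unitScalar_eq k (by
    rw [add_smul, unitScalar_smul_id, unitScalar_smul_id])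
  map_smul' c f := unitScalar_eq k (by
    rw [smul_eq_mul, mul_smul, unitScalar_smul_id]; rfl)

lemma unitScalar_sum {ι : Type*} (s : Finset ι) (f : ι → (𝟙_ C ⟶ 𝟙_ C)) :
    unitScalar k (∑ i ∈ s, f i) = ∑ i ∈ s, unitScalar k (f i) :=
  map_sum (unitScalarHom k C) f s

lemma unitScalar_smul (c : k) (f : 𝟙_ C ⟶ 𝟙_ C) :
    unitScalar k (c • f) = c * unitScalar k f :=
  (unitScalarHom k C).map_smul c f

lemma unitScalar_zero : unitScalar k (0 : 𝟙_ C ⟶ 𝟙_ C) = 0 := (unitScalarHom k C).map_zero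

lemma unitScalar_id : unitScalar k (𝟙 (𝟙_ C)) = 1 := unitScalar_eq k (one_smul _ _)

section
variable [SymmetricCategory C] [MonoidalPreadditive C] [MonoidalLinear k C] [RigidCategory C]

lemma catDim_congr {X Y : C} (i : X ≅ Y) : catDim k X = catDim k Y := by
  rw [catDim, catDim, catTrace_id_congr i]

lemma catDim_unit : catDim k (𝟙_ C) = 1 := by
  rw [catDim, catTrace_unit, unitScalar_id]

lemma catDim_tensor (X Y : C) : catDim k (X ⊗ Y) = catDim k X * catDim k Y := by
  rw [catDim, catTrace_id_tensor]
  apply unitScalar_eq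
  rw [← unitScalar_smul_id k (catTrace (𝟙 X)), ← unitScalar_smul_id k (catTrace (𝟙 Y))]
  simp only [MonoidalCategory.tensorHom_def, MonoidalLinear.smul_whiskerRight,
    MonoidalLinear.whiskerLeft_smul]
  simp [catDim, smul_smul, mul_comm]

lemma catDim_biproduct {n : ℕ} (S : Fin n → C) : catDim k (⨁ S) = ∑ i, catDim k (S i) := by
  rw [catDim, ← biproduct.total, catTrace_sum, unitScalar_sum]
  refine Finset.sum_congr rfl fun i _ => ?_
  rw [catTrace_comp_comm, biproduct.ι_π_self]
  rfl

/-- The dimension of an object in terms of the multiplicities of the simple objects in it. -/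
lemma sum_catDim_mul_finrank_hom (Z : C) [Fintype (SimpleClass C)] :
    ∑ s : SimpleClass C, catDim k s.rep * (Module.finrank k (Z ⟶ s.rep) : k) = catDim k Z := by
  have hfin : ∀ X Y : C, Module.Finite k (X ⟶ Y) := IsFusionCategory.finite_hom
  obtain ⟨n, S, hS, ⟨i⟩⟩ := IsFusionCategory.semisimple k Z
  rw [catDim_congr k i, catDim_biproduct]
  simp_rw [finrank_hom_congr k i (Iso.refl _), finrank_hom_biproduct_left, Nat.cast_sum,
    Finset.mul_sum]
  rw [Finset.sum_comm]
  refine Finset.sum_congr rfl fun j _ => ?_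
  have := hS j
  rw [Finset.sum_eq_single (simpleClass (S j))]
  · obtain ⟨e⟩ := (simpleClass_eq_iff (S j) _).1 rfl
    rw [finrank_hom_congr k (Iso.refl _) e.symm, finrank_endomorphism_simple_eq_one k (S j),
      Nat.cast_one, mul_one, catDim_congr k e]
  · intro s _ hs
    rw [(finrank_hom_simple_simple_eq_zero_iff k (S j) s.rep).2, Nat.cast_zero, mul_zero]
    exact ⟨fun e => hs ((simpleClass_eq_iff (S j) s).2 ⟨e⟩).symm⟩
  · simp

/-- The regular object `∑ dim(S) S`, tensored with any `W`, contains the unit object with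
multiplicity `dim W`: the multiplicity of `𝟙` in `S ⊗ W` is that of `S` in the dual of `W`, whose
dimension is that of `W`. -/
lemma sum_catDim_mul_finrank_hom_unit (W : C) [Fintype (SimpleClass C)] :
    ∑ s : SimpleClass C, catDim k s.rep * (Module.finrank k (𝟙_ C ⟶ s.rep ⊗ W) : k) =
      catDim k W := by
  rw [catDim, ← catTrace_id_eq_of_exactPairing (ᘁW) W]
  change _ = catDim k (ᘁW)
  rw [← sum_catDim_mul_finrank_hom]
  refine Finset.sum_congr rfl fun s _ => ?_
  rw [← finrank_hom_tensor_right k (𝟙_ C) (ᘁW) W s.rep,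
    finrank_hom_congr k (λ_ (ᘁW)) (Iso.refl _)]

/-- Unit projections exist by semisimplicity, and the trace of one is the multiplicity of the unit
object. -/
lemma exists_isUnitProjection (A : C) : ∃ e : A ⟶ A, IsUnitProjection e ∧
    unitScalar k (catTrace e) = Module.finrank k (𝟙_ C ⟶ A) := by
  classical
  have hfin : ∀ X Y : C, Module.Finite k (X ⟶ Y) := IsFusionCategory.finite_hom
  have : Simple (𝟙_ C) := IsFusionCategory.simple_unit k
  obtain ⟨n, S, hS, ⟨i⟩⟩ := IsFusionCategory.semisimple k A
  -- on a simple summand the projection is the identity if the summand is `𝟙`, and zero otherwise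
  have h : ∀ j, ∃ (ι : 𝟙_ C ⟶ S j) (π : S j ⟶ 𝟙_ C),
      (∀ v : 𝟙_ C ⟶ S j, v ≫ π ≫ ι = v) ∧ (∀ φ : S j ⟶ 𝟙_ C, π ≫ ι ≫ φ = φ) ∧
      unitScalar k (ι ≫ π) = Module.finrank k (𝟙_ C ⟶ S j) := by
    intro j
    have := hS j
    by_cases hj : Nonempty (S j ≅ 𝟙_ C)
    · obtain ⟨e⟩ := hj
      refine ⟨e.inv, e.hom, by simp, by simp, ?_⟩
      rw [finrank_hom_congr k (Iso.refl _) e, finrank_endomorphism_simple_eq_one k (𝟙_ C)]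
      simp [unitScalar_id]
    · have h₀ : ∀ v : 𝟙_ C ⟶ S j, v = 0 := fun v => by
        by_contra hv
        have := isIso_of_hom_simple hv
        exact hj ⟨(asIso v).symm⟩
      have h₁ : ∀ v : S j ⟶ 𝟙_ C, v = 0 := fun v => by
        by_contra hv
        have := isIso_of_hom_simple hv
        exact hj ⟨asIso v⟩
      refine ⟨0, 0, fun v => by simp [h₀ v], fun φ => by simp [h₁ φ], ?_⟩
      have : Subsingleton (𝟙_ C ⟶ S j) := ⟨fun a b => (h₀ a).trans (h₀ b).symm⟩
      rw [Module.finrank_zero_of_subsingleton]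
      simp [unitScalar_zero]
  choose ι π hι hπ hιπ using h
  refine ⟨∑ j, (i.hom ≫ biproduct.π S j ≫ π j) ≫ (ι j ≫ biproduct.ι S j ≫ i.inv),
    ⟨fun v => ?_, fun φ => ?_, n, _, _, rfl⟩, ?_⟩
  · have h : ∀ j, v ≫ (i.hom ≫ biproduct.π S j ≫ π j) ≫ (ι j ≫ biproduct.ι S j ≫ i.inv) =
        (v ≫ i.hom) ≫ (biproduct.π S j ≫ biproduct.ι S j) ≫ i.inv := fun j => by
      simpa using congrArg (· ≫ biproduct.ι S j ≫ i.inv) (hι j (v ≫ i.hom ≫ biproduct.π S j))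
    rw [Preadditive.comp_sum, Finset.sum_congr rfl fun j _ => h j, ← Preadditive.comp_sum,
      ← Preadditive.sum_comp, biproduct.total]
    simp
  · have h : ∀ j, ((i.hom ≫ biproduct.π S j ≫ π j) ≫ (ι j ≫ biproduct.ι S j ≫ i.inv)) ≫ φ =
        i.hom ≫ (biproduct.π S j ≫ biproduct.ι S j) ≫ i.inv ≫ φ := fun j => by
      simpa using congrArg (i.hom ≫ biproduct.π S j ≫ ·) (hπ j (biproduct.ι S j ≫ i.inv ≫ φ))
    rw [Preadditive.sum_comp, Finset.sum_congr rfl fun j _ => h j, ← Preadditive.comp_sum,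
      ← Preadditive.sum_comp, biproduct.total]
    simp
  · rw [catTrace_sum, unitScalar_sum, finrank_hom_congr k (Iso.refl _) i,
      finrank_hom_biproduct_right, Nat.cast_sum]
    refine Finset.sum_congr rfl fun j _ => ?_
    rw [catTrace_comp_unit, ← hιπ]
    simp

end

end FusionDim

/-! ### Traces of linear maps and of representations -/

section VectorSpaces

variable {k : Type w} [Field k]

/-- A vector, as a morphism from the unit object of the category of finite dimensional spaces. -/
def fgVec {V : FGModuleCat.{w} k} (x : V) : 𝟙_ (FGModuleCat.{w} k) ⟶ V :=
  FGModuleCat.ofHom (LinearMap.toSpanSingleton k V x)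

/-- A linear form, as a morphism to the unit object of the category of finite dimensional spaces. -/
def fgFun {V : FGModuleCat.{w} k} (φ : V →ₗ[k] k) : V ⟶ 𝟙_ (FGModuleCat.{w} k) :=
  FGModuleCat.ofHom φ

lemma fg_sum_hom {V W : FGModuleCat.{w} k} {ι : Type*} (s : Finset ι) (f : ι → (V ⟶ W)) :
    (∑ i ∈ s, f i).hom.hom = ∑ i ∈ s, (f i).hom.hom := by
  classical
  induction s using Finset.induction_on with
  | empty => rfl
  | insert a s ha ih => rw [Finset.sum_insert ha, Finset.sum_insert ha, ← ih]; rfl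

/-- In finite dimensional vector spaces the categorical trace is the usual one. -/
lemma catTrace_fgModuleCat {V : FGModuleCat.{w} k} (f : V ⟶ V) :
    catTrace f = LinearMap.trace k V f.hom.hom • 𝟙 (𝟙_ (FGModuleCat.{w} k)) := by
  let b := Module.finBasis k V
  have hf : f = ∑ i, fgFun (b.coord i) ≫ fgVec (b i) ≫ f := by
    apply FGModuleCat.hom_ext
    rw [fg_sum_hom]
    refine b.ext fun j => ?_
    rw [LinearMap.sum_apply, Finset.sum_eq_single j]
    · change _ = f.hom.hom ((b.coord j (b j)) • b j)
      simp
    · intro i _ hij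
      change f.hom.hom ((b.coord i (b j)) • b i) = 0
      simp [Finsupp.single_eq_of_ne hij]
    · simp
  have h : ∀ i, fgVec (b i) ≫ f ≫ fgFun (b.coord i) =
      b.coord i (f.hom.hom (b i)) • 𝟙 (𝟙_ (FGModuleCat.{w} k)) := by
    intro i
    apply FGModuleCat.hom_ext
    refine LinearMap.ext_ring ?_
    change b.coord i (f.hom.hom ((1 : k) • b i)) = b.coord i (f.hom.hom (b i)) • (1 : k)
    simp
  rw [LinearMap.trace_eq_matrix_trace k b, Matrix.trace, Finset.sum_smul]
  conv_lhs => rw [hf, catTrace_sum]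
  refine Finset.sum_congr rfl fun i _ => ?_
  rw [catTrace_comp_unit, Category.assoc, h]
  simp [LinearMap.toMatrix_apply]

lemma IsNegligible.trace_eq_zero {G : Type*} [Group G] {V : FDRep k G} {m : V ⟶ V}
    (hm : IsNegligible m) (u : V ⟶ V) :
    LinearMap.trace k V.V (m ≫ u).hom.hom.hom = 0 := by
  have h := congrArg Action.Hom.hom (hm u)
  rw [hom_catTrace, catTrace_fgModuleCat] at h
  have h' := congrArg (fun f : 𝟙_ (FGModuleCat.{w} k) ⟶ 𝟙_ (FGModuleCat.{w} k) =>
    (f.hom.hom (1 : k) : k)) h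
  change LinearMap.trace k V.V (m ≫ u).hom.hom.hom * (1 : k) = 0 at h'
  simpa using h'

end VectorSpaces

/-! ### The functor from representations to equivariant objects -/

section Box

variable (k : Type w) [Field k] [IsAlgClosed k] {C : Type u} [Category.{v} C] [Abelian C]
  [Linear k C] [MonoidalCategory C] [SymmetricCategory C] [MonoidalPreadditive C]
  [MonoidalLinear k C] [RigidCategory C] [IsFusionCategory k C] {G : Type} [Group G]

/-- The matrix of a linear map in the bases used by `vecFunctor`. -/
abbrev fgMatrix {V W : FGModuleCat.{w} k} (f : V ⟶ W) :
    Matrix (Fin (Module.finrank k W)) (Fin (Module.finrank k V)) k :=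
  LinearMap.toMatrix (Module.finBasis k V) (Module.finBasis k W) f.hom.hom

variable (C) in
/-- The inclusion of the `i`-th copy of `𝟙` in `V ⊗ 𝟙`. -/
def vecι (V : FGModuleCat.{w} k) (i : Fin (Module.finrank k V)) :
    𝟙_ C ⟶ (vecFunctor k C).obj V :=
  biproduct.ι (fun _ : Fin (Module.finrank k V) => 𝟙_ C) i

variable (C) in
/-- The projection of `V ⊗ 𝟙` to the `i`-th copy of `𝟙`. -/
def vecπ (V : FGModuleCat.{w} k) (i : Fin (Module.finrank k V)) :
    (vecFunctor k C).obj V ⟶ 𝟙_ C :=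
  biproduct.π (fun _ : Fin (Module.finrank k V) => 𝟙_ C) i

lemma sum_vecπ_vecι (V : FGModuleCat.{w} k) :
    ∑ i, vecπ k C V i ≫ vecι k C V i = 𝟙 _ :=
  biproduct.total

lemma vecι_map_vecπ {V W : FGModuleCat.{w} k} (f : V ⟶ W) (i : Fin (Module.finrank k V))
    (j : Fin (Module.finrank k W)) :
    vecι k C V i ≫ (vecFunctor k C).map f ≫ vecπ k C W j = fgMatrix k f j i • 𝟙 (𝟙_ C) :=
  biproduct.matrix_components _ _ _

instance : (vecFunctor k C).Additive where
  map_add {V W f g} := by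
    apply biproduct.hom_ext'
    intro i
    apply biproduct.hom_ext
    intro j
    change (vecι k C V i ≫ (vecFunctor k C).map (f + g)) ≫ vecπ k C W j =
      (vecι k C V i ≫ ((vecFunctor k C).map f + (vecFunctor k C).map g)) ≫ vecπ k C W j
    rw [Category.assoc, Category.assoc, Preadditive.add_comp, Preadditive.comp_add,
      vecι_map_vecπ, vecι_map_vecπ, vecι_map_vecπ, ← add_smul]
    congr 1
    exact congrArg (fun M => M j i) (map_add (LinearMap.toMatrix (Module.finBasis k V)
      (Module.finBasis k W)) f.hom.hom g.hom.hom)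

lemma vecι_map {V : FGModuleCat.{w} k} (f : V ⟶ V) (i : Fin (Module.finrank k V)) :
    vecι k C V i ≫ (vecFunctor k C).map f = ∑ l, fgMatrix k f l i • vecι k C V l := by
  conv_lhs => rw [← Category.comp_id ((vecFunctor k C).map f), ← sum_vecπ_vecι,
    Preadditive.comp_sum, Preadditive.comp_sum]
  refine Finset.sum_congr rfl fun l _ => ?_
  rw [← Category.assoc, ← Category.assoc, Category.assoc (vecι k C V i), vecι_map_vecπ]
  simp

lemma map_vecπ {V : FGModuleCat.{w} k} (f : V ⟶ V) (j : Fin (Module.finrank k V)) :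
    (vecFunctor k C).map f ≫ vecπ k C V j = ∑ l, fgMatrix k f j l • vecπ k C V l := by
  conv_lhs => rw [← Category.id_comp ((vecFunctor k C).map f), ← sum_vecπ_vecι,
    Preadditive.sum_comp, Preadditive.sum_comp]
  refine Finset.sum_congr rfl fun l _ => ?_
  rw [Category.assoc, Category.assoc, vecι_map_vecπ]
  simp

variable {k}

/-- The matrix of traces of the components of an endomorphism of `X ⊗ (V ⊗ 𝟙)`. -/
def traceMatrix {X : C} {V : FGModuleCat.{w} k}
    (h : X ⊗ (vecFunctor k C).obj V ⟶ X ⊗ (vecFunctor k C).obj V) :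
    Matrix (Fin (Module.finrank k V)) (Fin (Module.finrank k V)) k :=
  fun j i => unitScalar k (catTrace (X ◁ vecι k C V i ≫ h ≫ X ◁ vecπ k C V j))

lemma traceMatrix_map_comp {X : C} {V : FGModuleCat.{w} k} (f : V ⟶ V)
    (h : X ⊗ (vecFunctor k C).obj V ⟶ X ⊗ (vecFunctor k C).obj V) :
    traceMatrix (X ◁ (vecFunctor k C).map f ≫ h) = traceMatrix h * fgMatrix k f := by
  ext j i
  rw [Matrix.mul_apply, traceMatrix, Category.assoc, ← Category.assoc, ← whiskerLeft_comp, vecι_map,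
    whiskerLeft_sum, Preadditive.sum_comp, catTrace_sum, unitScalar_sum]
  refine Finset.sum_congr rfl fun l _ => ?_
  rw [MonoidalLinear.whiskerLeft_smul, Linear.smul_comp, catTrace_smul, unitScalar_smul, mul_comm]
  rfl

lemma traceMatrix_comp_map {X : C} {V : FGModuleCat.{w} k} (f : V ⟶ V)
    (h : X ⊗ (vecFunctor k C).obj V ⟶ X ⊗ (vecFunctor k C).obj V) :
    traceMatrix (h ≫ X ◁ (vecFunctor k C).map f) = fgMatrix k f * traceMatrix h := by
  ext j i
  rw [Matrix.mul_apply, traceMatrix, Category.assoc, ← whiskerLeft_comp, map_vecπ,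
    whiskerLeft_sum, Preadditive.comp_sum, Preadditive.comp_sum, catTrace_sum, unitScalar_sum]
  refine Finset.sum_congr rfl fun l _ => ?_
  rw [MonoidalLinear.whiskerLeft_smul, Linear.comp_smul, Linear.comp_smul, catTrace_smul,
    unitScalar_smul]
  rfl

lemma trace_traceMatrix {X : C} {V : FGModuleCat.{w} k}
    (h : X ⊗ (vecFunctor k C).obj V ⟶ X ⊗ (vecFunctor k C).obj V) :
    (traceMatrix h).trace = unitScalar k (catTrace h) := by
  conv_rhs => rw [← Category.comp_id h, ← whiskerLeft_id, ← sum_vecπ_vecι,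
    whiskerLeft_sum, Preadditive.comp_sum, catTrace_sum, unitScalar_sum]
  refine Finset.sum_congr rfl fun i _ => ?_
  rw [whiskerLeft_comp, ← Category.assoc, catTrace_comp_comm]
  rfl

/-- The functor `V ↦ X ⊗ (V ⊗ 𝟙)` takes negligible endomorphisms of representations to negligible
ones: the matrix of partial traces over `X` of an equivariant endomorphism of `X ⊗ (V ⊗ 𝟙)`
defines an equivariant endomorphism of `V`. -/
lemma IsNegligible.box (X : C) {V : FDRep k G} {m : V ⟶ V} (hm : IsNegligible m) :
    IsNegligible (Action.trivial G X ◁ ((vecFunctor k C).mapAction G).map m) := by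
  intro h
  apply Action.Hom.ext
  rw [hom_catTrace]
  let h' : X ⊗ (vecFunctor k C).obj V.V ⟶ X ⊗ (vecFunctor k C).obj V.V := h.hom
  let b := Module.finBasis k V.V
  have hcomm : ∀ g, fgMatrix k (Action.ρ V g) * traceMatrix h' =
      traceMatrix h' * fgMatrix k (Action.ρ V g) := by
    intro g
    rw [← traceMatrix_map_comp, ← traceMatrix_comp_map]
    have hρ : (Action.trivial G X ⊗ ((vecFunctor k C).mapAction G).obj V).ρ g =
        X ◁ (vecFunctor k C).map (Action.ρ V g) := id_tensorHom _ _
    have hc := h.comm g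
    rw [hρ] at hc
    exact congrArg (fun f => traceMatrix f) hc.symm
  let u : V ⟶ V :=
    { hom := FGModuleCat.ofHom (Matrix.toLin b b (traceMatrix h'))
      comm := fun g => by
        apply FGModuleCat.hom_ext
        apply (LinearMap.toMatrix b b).injective
        change LinearMap.toMatrix b b
            (Matrix.toLin b b (traceMatrix h') ∘ₗ (Action.ρ V g).hom.hom) =
          LinearMap.toMatrix b b ((Action.ρ V g).hom.hom ∘ₗ Matrix.toLin b b (traceMatrix h'))
        rw [LinearMap.toMatrix_comp b b b, LinearMap.toMatrix_comp b b b,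
          LinearMap.toMatrix_toLin]
        exact (hcomm g).symm }
  have key := hm.trace_eq_zero u
  rw [LinearMap.trace_eq_matrix_trace k b] at key
  change (LinearMap.toMatrix b b (Matrix.toLin b b (traceMatrix h') ∘ₗ m.hom.hom.hom)).trace = 0
    at key
  rw [LinearMap.toMatrix_comp b b b, LinearMap.toMatrix_toLin] at key
  change (traceMatrix h' * fgMatrix k m.hom).trace = 0 at key
  rw [← traceMatrix_map_comp, trace_traceMatrix] at key
  change catTrace (X ◁ (vecFunctor k C).map m.hom ≫ h') = 0
  rw [← unitScalar_smul_id k (catTrace _), key, zero_smul]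

end Box

/-! ### Multiplicities of the unit object in equivariant objects -/

section KeyVanishing

lemma biproduct_unit_ρ_eq_id (k : Type w) [Field k] {G : Type} [Group G]
    {n : ℕ} (g : G) :
    Action.ρ (⨁ fun _ : Fin n => 𝟙_ (FDRep k G)) g = 𝟙 _ := by
  have h : ∀ i, (biproduct.ι (fun _ : Fin n => 𝟙_ (FDRep k G)) i).hom ≫
      Action.ρ (⨁ fun _ : Fin n => 𝟙_ (FDRep k G)) g =
        (biproduct.ι (fun _ : Fin n => 𝟙_ (FDRep k G)) i).hom := fun i => by
    rw [← (biproduct.ι (fun _ : Fin n => 𝟙_ (FDRep k G)) i).comm g]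
    exact Category.id_comp _
  have ht := congrArg Action.Hom.hom (biproduct.total (f := fun _ : Fin n => 𝟙_ (FDRep k G)))
  rw [Action.sum_hom] at ht
  have h' : (𝟙 (⨁ fun _ : Fin n => 𝟙_ (FDRep k G)) : _ ⟶ _).hom ≫
      Action.ρ (⨁ fun _ : Fin n => 𝟙_ (FDRep k G)) g =
        (𝟙 (⨁ fun _ : Fin n => 𝟙_ (FDRep k G)) : _ ⟶ _).hom := by
    conv_lhs => rw [← ht, Preadditive.sum_comp]
    conv_rhs => rw [← ht]
    refine Finset.sum_congr rfl fun i _ => ?_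
    rw [Action.comp_hom, Category.assoc, h]
  exact (Category.id_comp _).symm.trans h'

/-- If all equivariant morphisms `𝟙 ⟶ Z` are negligible, then an endomorphism of `Z` which factors
through an object with trivial action has trace zero on the largest summand of `Z` which is a sum of
copies of `𝟙`: all morphisms between `𝟙` and an object with trivial action are equivariant. -/
lemma catTrace_eq_zero_of_trivial (k : Type*) [Field k] [IsAlgClosed k]
    {C : Type u} [Category.{v} C] [Abelian C] [Linear k C] [MonoidalCategory C]
    [SymmetricCategory C] [MonoidalPreadditive C] [MonoidalLinear k C] [RigidCategory C]
    [IsFusionCategory k C] {G : Type} [Group G] {Z B : Action C G}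
    (hZ : ∀ v : 𝟙_ (Action C G) ⟶ Z, IsNegligible v) (hB : ∀ g, B.ρ g = 𝟙 _)
    (a : Z ⟶ B) (b : B ⟶ Z) (e : Z ⟶ Z) (he : IsUnitProjection e.hom) :
    catTrace (a ≫ b ≫ e) = 0 := by
  obtain ⟨e₁, he₁, -⟩ := exists_isUnitProjection k B.V
  obtain ⟨n, ι, π, h⟩ := he₁.exists_eq_sum
  let ι' : ∀ j, 𝟙_ (Action C G) ⟶ B := fun j =>
    { hom := ι j
      comm := fun g => by
        rw [hB]; exact (Category.id_comp _).trans (Category.comp_id _).symm }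
  let π' : ∀ j, B ⟶ 𝟙_ (Action C G) := fun j =>
    { hom := π j
      comm := fun g => by
        rw [hB]; exact (Category.id_comp _).trans (Category.comp_id _).symm }
  -- the unit projection is moved from `Z` to `B`, where its components are equivariant
  have hbe : b ≫ e = ∑ j, π' j ≫ ι' j ≫ b := by
    apply Action.Hom.ext
    rw [Action.sum_hom, Action.comp_hom, ← he₁.naturality he b.hom, h, Preadditive.sum_comp]
    refine Finset.sum_congr rfl fun j _ => ?_
    rw [Category.assoc]
    rfl
  rw [catTrace_comp_comm, hbe, Preadditive.sum_comp, catTrace_sum]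
  refine Finset.sum_eq_zero fun j _ => ?_
  rw [Category.assoc, catTrace_comp_comm, Category.assoc]
  exact hZ (ι' j ≫ b) (a ≫ π' j)

variable (k : Type w) [Field k] [IsAlgClosed k] {C : Type u} [Category.{v} C] [Abelian C]
  [Linear k C] [MonoidalCategory C] [SymmetricCategory C] [MonoidalPreadditive C]
  [MonoidalLinear k C] [RigidCategory C] [IsFusionCategory k C] {G : Type} [Group G]

/-- If all equivariant morphisms `𝟙 ⟶ Z` are negligible, and `Z` is up to negligible morphisms a
direct summand of some `X ⊗ (V ⊗ 𝟙)`, where `V` is up to negligible morphisms a sum of trivial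
representations, then the multiplicity of the unit object in `Z` vanishes in `k`. It is the trace of
the unit projection `e`, and `𝟙 Z` can be replaced in this trace by a composition through an object
with trivial action. -/
lemma finrank_hom_unit_eq_zero {Z : Action C G} {X : C} {V : FDRep k G} {n : ℕ}
    (hZ : ∀ v : 𝟙_ (Action C G) ⟶ Z, IsNegligible v)
    (f : V ⟶ ⨁ fun _ : Fin n => 𝟙_ (FDRep k G)) (g : (⨁ fun _ : Fin n => 𝟙_ (FDRep k G)) ⟶ V)
    (hfg : IsNegligible (f ≫ g - 𝟙 V))
    (a : Z ⟶ Action.trivial G X ⊗ ((vecFunctor k C).mapAction G).obj V)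
    (b : Action.trivial G X ⊗ ((vecFunctor k C).mapAction G).obj V ⟶ Z)
    (hab : IsNegligible (a ≫ b - 𝟙 Z)) :
    (Module.finrank k (𝟙_ C ⟶ Z.V) : k) = 0 := by
  obtain ⟨e₀, he₀, htr⟩ := exists_isUnitProjection k Z.V
  let e : Z ⟶ Z := { hom := e₀, comm := fun g => (he₀.naturality he₀ (Z.ρ g)).symm }
  have hE : (Action.trivial G X ◁ ((vecFunctor k C).mapAction G).map (f ≫ g - 𝟙 V)) =
      (Action.trivial G X ◁ ((vecFunctor k C).mapAction G).map f) ≫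
        (Action.trivial G X ◁ ((vecFunctor k C).mapAction G).map g) - 𝟙 _ := by
    rw [← whiskerLeft_comp, ← CategoryTheory.Functor.map_comp, ← whiskerLeft_id,
      ← CategoryTheory.Functor.map_id]
    apply Action.Hom.ext
    change X ◁ (vecFunctor k C).map ((f ≫ g).hom - (𝟙 V : V ⟶ V).hom) =
      X ◁ (vecFunctor k C).map (f ≫ g).hom - X ◁ (vecFunctor k C).map (𝟙 V : V ⟶ V).hom
    rw [Functor.map_sub]
    exact (tensorLeft X).map_sub
  -- In the trace of `e`, first `𝟙 Z` is replaced by `a ≫ b`, then `𝟙 V` by `f ≫ g`.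
  have h₁ : catTrace e = catTrace (a ≫ b ≫ e) := by
    have h := hab e
    rw [Preadditive.sub_comp, catTrace_sub, Category.id_comp, Category.assoc] at h
    exact (sub_eq_zero.1 h).symm
  have h₂ : catTrace (a ≫ b ≫ e) =
      catTrace ((a ≫ (Action.trivial G X ◁ ((vecFunctor k C).mapAction G).map f)) ≫
        ((Action.trivial G X ◁ ((vecFunctor k C).mapAction G).map g) ≫ b) ≫ e) := by
    have h := hfg.box X (b ≫ e ≫ a)
    rw [hE, Preadditive.sub_comp, catTrace_sub, Category.id_comp] at h
    calc catTrace (a ≫ b ≫ e) = catTrace (b ≫ e ≫ a) := by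
          rw [catTrace_comp_comm, Category.assoc]
      _ = _ := (sub_eq_zero.1 h).symm
      _ = _ := by
          rw [Category.assoc a, catTrace_comp_comm a]
          simp only [Category.assoc]
  have h₃ := catTrace_eq_zero_of_trivial k hZ (fun γ => ?_)
    (a ≫ (Action.trivial G X ◁ ((vecFunctor k C).mapAction G).map f))
    ((Action.trivial G X ◁ ((vecFunctor k C).mapAction G).map g) ≫ b) e he₀
  · rw [← htr]
    have h := congrArg Action.Hom.hom (h₁.trans (h₂.trans h₃))
    rw [hom_catTrace] at h
    change catTrace e₀ = 0 at h
    rw [h, unitScalar_zero]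
  · change 𝟙 X ⊗ₘ (vecFunctor k C).map
      (Action.ρ (⨁ fun _ : Fin n => 𝟙_ (FDRep k G)) γ) = 𝟙 _
    rw [biproduct_unit_ρ_eq_id, CategoryTheory.Functor.map_id]
    exact id_tensorHom_id _ _

end KeyVanishing

/-! ### Consequences of the hypotheses on the Frobenius functor -/

section Frobenius

lemma tpowMap_zero {C : Type u} [Category.{v} C] [MonoidalCategory C] [Preadditive C]
    [MonoidalPreadditive C] {X Y : C} {n : ℕ} (hn : n ≠ 0) :
    tpowMap (0 : X ⟶ Y) n = 0 := by
  obtain ⟨n, rfl⟩ := Nat.exists_eq_succ_of_ne_zero hn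
  simp [tpowMap]

/-- All tensor powers of the unit object are the unit object. -/
def tpowUnitIso (C : Type u) [Category.{v} C] [MonoidalCategory C] :
    (n : ℕ) → (tpow (𝟙_ C) n ≅ 𝟙_ C)
  | 0 => Iso.refl _
  | n + 1 => λ_ _ ≪≫ tpowUnitIso C n

/-- The cyclic permutation acts trivially on the `p`-th tensor power of the unit object: it acts by
a `p`-th root of unity, and there is only one in characteristic `p`. -/
lemma cyc_unit (k : Type*) [Field k] [IsAlgClosed k] (p : ℕ) [Fact p.Prime] [CharP k p]
    (C : Type u) [Category.{v} C] [Abelian C] [Linear k C] [MonoidalCategory C]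
    [SymmetricCategory C] [IsFusionCategory k C] : cyc (𝟙_ C) p = 1 := by
  have : Simple (𝟙_ C) := IsFusionCategory.simple_unit k
  have : Simple (tpow (𝟙_ C) p) := Simple.of_iso (tpowUnitIso C p)
  have : FiniteDimensional k (tpow (𝟙_ C) p ⟶ tpow (𝟙_ C) p) := IsFusionCategory.finite_hom _ _
  obtain ⟨c, hc⟩ := endomorphism_simple_eq_smul_id k (cyc (𝟙_ C) p)
  have hc' : cyc (𝟙_ C) p = c • (1 : End (tpow (𝟙_ C) p)) := hc.symm
  have h := cyc_pow_self (𝟙_ C) p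
  rw [hc', smul_pow, one_pow] at h
  have h' : c ^ p = 1 := by
    refine smul_left_injective k (id_nonzero (tpow (𝟙_ C) p)) ?_
    exact h.trans (one_smul _ _).symm
  have h1 : c = 1 := by
    have : (c - 1) ^ p = 0 := by rw [sub_pow_char, h', one_pow, sub_self]
    exact sub_eq_zero.1 (pow_eq_zero_iff (Fact.out : p.Prime).ne_zero |>.1 this)
  rw [hc', h1, one_smul]

/-- If there are no nonzero morphisms `𝟙 ⟶ X`, then fullness of the Frobenius functor leaves no
nonzero morphisms from `𝟙 = Fr 𝟙` to `Fr X`. -/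
lemma isNegligible_of_full (k : Type*) [Field k] [IsAlgClosed k] (p : ℕ) [Fact p.Prime]
    [CharP k p] {C : Type u} [Category.{v} C] [Abelian C] [Linear k C] [MonoidalCategory C]
    [SymmetricCategory C] [MonoidalPreadditive C] [RigidCategory C] [IsFusionCategory k C]
    (hfull : (frobeniusFunctor p C).Full) {X : C}
    (hX : ∀ f : 𝟙_ C ⟶ X, f = 0)
    (v : 𝟙_ (Action C (Cp p)) ⟶ (tpowFunctor C p).obj X) :
    IsNegligible v := by
  -- the unit object with trivial action is the Frobenius image of the unit object
  let i : (tpowFunctor C p).obj (𝟙_ C) ≅ 𝟙_ (Action C (Cp p)) :=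
    Action.mkIso (tpowUnitIso C p) (fun g => by
      have h : ((tpowFunctor C p).obj (𝟙_ C)).ρ g = 𝟙 (tpow (𝟙_ C) p) := by
        change cyc (𝟙_ C) p ^ _ = _
        rw [cyc_unit k p C, one_pow]
        rfl
      rw [h]
      exact (Category.id_comp _).trans (Category.comp_id _).symm)
  obtain ⟨f, hf⟩ := hfull.map_surjective
    (X := 𝟙_ C) (Y := X) ((toNegQuot (Action C (Cp p))).map (i.hom ≫ v))
  have h0 : (tpowFunctor C p).map f = 0 := by
    apply Action.Hom.ext
    change tpowMap f p = 0
    rw [hX f, tpowMap_zero (Fact.out : p.Prime).ne_zero]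
  have h1 := (toNegQuot_map_eq_iff _ _).1 hf
  rw [h0, zero_sub] at h1
  intro u
  have h2 := h1 (u ≫ i.inv)
  rw [Preadditive.neg_comp, catTrace_neg, neg_eq_zero, Category.assoc, catTrace_comp_comm] at h2
  simpa using h2

/-- For a simple object `X` other than the unit object, the multiplicity of the unit object in
`X^{⊗ p}` is divisible by `p`. -/
lemma finrank_hom_unit_tpow (k : Type w) [Field k] [IsAlgClosed k] (p : ℕ) [Fact p.Prime]
    [CharP k p] {C : Type u} [Category.{v} C] [Abelian C] [Linear k C] [MonoidalCategory C]
    [SymmetricCategory C] [MonoidalPreadditive C] [MonoidalLinear k C] [RigidCategory C]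
    [IsFusionCategory k C] (hfull : (frobeniusFunctor p C).Full)
    (htype : ∀ X : C, boxSub k p C (vecSub k p) ((frobeniusFunctor p C).obj X))
    {X : C} (hX : ∀ f : 𝟙_ C ⟶ X, f = 0) :
    (Module.finrank k (𝟙_ C ⟶ tpow X p) : k) = 0 := by
  obtain ⟨X', V, ⟨n, ⟨iV⟩⟩, ⟨r⟩⟩ := htype X
  obtain ⟨a, ha⟩ := (toNegQuot (Action C (Cp p))).map_surjective r.i
  obtain ⟨b, hb⟩ := (toNegQuot (Action C (Cp p))).map_surjective r.r
  obtain ⟨f, hf⟩ := (toNegQuot (FDRep k (Cp p))).map_surjective iV.hom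
  obtain ⟨g, hg⟩ := (toNegQuot (FDRep k (Cp p))).map_surjective iV.inv
  refine finrank_hom_unit_eq_zero k (Z := (tpowFunctor C p).obj X)
    (isNegligible_of_full k p hfull hX) f g ?_ a b ?_
  · rw [← toNegQuot_map_eq_iff, Functor.map_comp, hf, hg]
    exact iV.hom_inv_id
  · rw [← toNegQuot_map_eq_iff, Functor.map_comp, ha, hb]
    exact r.retract

end Frobenius

/-! ### Multiplicities of the unit object in tensor products of simple objects -/

section TensorWords

variable {C : Type u} [Category.{v} C] [MonoidalCategory C]

/-- The tensor product of a list of objects. -/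
def listTensor : List C → C
  | [] => 𝟙_ C
  | X :: l => X ⊗ listTensor l

lemma listTensor_replicate (X : C) (n : ℕ) : listTensor (List.replicate n X) = tpow X n := by
  induction n with
  | zero => rfl
  | succ n ih => rw [List.replicate_succ, listTensor, ih]

lemma nonempty_listTensor_iso_of_perm [BraidedCategory C] {l l' : List C} (h : l.Perm l') :
    Nonempty (listTensor l ≅ listTensor l') := by
  induction h with
  | nil => exact ⟨Iso.refl _⟩
  | cons X _ ih => exact ih.map fun e => whiskerLeftIso X e
  | swap X Y l =>
    exact ⟨(α_ Y X (listTensor l)).symm ≪≫ whiskerRightIso (β_ Y X) _ ≪≫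
      α_ X Y (listTensor l)⟩
  | trans _ _ ih₁ ih₂ =>
    obtain ⟨e₁⟩ := ih₁
    obtain ⟨e₂⟩ := ih₂
    exact ⟨e₁ ≪≫ e₂⟩

/-- The isomorphism of tensor powers induced by an isomorphism. -/
def tpowIso {X Y : C} (e : X ≅ Y) (n : ℕ) : tpow X n ≅ tpow Y n where
  hom := tpowMap e.hom n
  inv := tpowMap e.inv n
  hom_inv_id := by rw [← tpowMap_comp, e.hom_inv_id, tpowMap_id]
  inv_hom_id := by rw [← tpowMap_comp, e.inv_hom_id, tpowMap_id]

end TensorWords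

section Counting

variable (k : Type w) [Field k] [IsAlgClosed k] (C : Type u) [Category.{v} C] [Abelian C]
  [Linear k C] [MonoidalCategory C] [SymmetricCategory C] [MonoidalPreadditive C]
  [MonoidalLinear k C] [RigidCategory C] [IsFusionCategory k C]

variable {C} in
/-- The tensor product of the simple objects occurring in a monomial, in some order. -/
def monomialTensor (m : SimpleClass C →₀ ℕ) : C :=
  listTensor ((Finsupp.toMultiset m).toList.map SimpleClass.rep)

/-- The linear functional on polynomials in the classes of simple objects which takes a monomial
to the multiplicity of the unit object in the corresponding tensor product. -/
def unitMultiplicity : MvPolynomial (SimpleClass C) k →ₗ[k] k :=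
  (MvPolynomial.basisMonomials (SimpleClass C) k).constr k
    fun m => (Module.finrank k (𝟙_ C ⟶ monomialTensor m) : k)

lemma unitMultiplicity_monomial (m : SimpleClass C →₀ ℕ) :
    unitMultiplicity k C (MvPolynomial.monomial m 1) =
      Module.finrank k (𝟙_ C ⟶ monomialTensor m) := by
  have h : MvPolynomial.monomial m 1 = MvPolynomial.basisMonomials (SimpleClass C) k m := by simp
  rw [h, unitMultiplicity, Module.Basis.constr_basis]

/-- The algebra homomorphism taking the class of a simple object to its dimension. -/
def dimEval : MvPolynomial (SimpleClass C) k →ₐ[k] k :=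
  MvPolynomial.aeval fun s => catDim k s.rep

/-- The polynomial `∑ dim(X) X`, with one summand for each isomorphism class of simple objects. -/
def regularElement [Fintype (SimpleClass C)] : MvPolynomial (SimpleClass C) k :=
  ∑ s, catDim k s.rep • MvPolynomial.X s

lemma dimEval_monomial (m : SimpleClass C →₀ ℕ) :
    dimEval k C (MvPolynomial.monomial m 1) = catDim k (monomialTensor m) := by
  have h : ∀ l : List (SimpleClass C), catDim k (listTensor (l.map SimpleClass.rep)) =
      (l.map fun s => catDim k s.rep).prod := by
    intro l
    induction l with
    | nil => exact catDim_unit k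
    | cons s l ih => rw [List.map_cons, listTensor, catDim_tensor, ih, List.map_cons,
        List.prod_cons]
  rw [monomialTensor, h, ← Multiset.prod_coe, ← Multiset.map_coe, Multiset.coe_toList,
    Finsupp.toMultiset_map, Finsupp.prod_toMultiset, Finsupp.prod_mapDomain_index pow_zero pow_add]
  simp [dimEval, MvPolynomial.aeval_monomial]

/-- The regular element turns multiplicities of the unit object into dimensions. -/
lemma unitMultiplicity_regularElement_mul [Fintype (SimpleClass C)]
    (P : MvPolynomial (SimpleClass C) k) :
    unitMultiplicity k C (regularElement k C * P) = dimEval k C P := by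
  have h : unitMultiplicity k C ∘ₗ LinearMap.mulLeft k (regularElement k C) =
      (dimEval k C).toLinearMap := by
    refine (MvPolynomial.basisMonomials (SimpleClass C) k).ext fun m => ?_
    rw [MvPolynomial.coe_basisMonomials, LinearMap.comp_apply, LinearMap.mulLeft_apply,
      AlgHom.toLinearMap_apply, dimEval_monomial, regularElement, Finset.sum_mul, map_sum,
      ← sum_catDim_mul_finrank_hom_unit]
    refine Finset.sum_congr rfl fun s _ => ?_
    rw [smul_mul_assoc, map_smul, smul_eq_mul, MvPolynomial.X, MvPolynomial.monomial_mul,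
      one_mul, unitMultiplicity_monomial]
    have hperm : ((Finsupp.toMultiset (Finsupp.single s 1 + m)).toList.map SimpleClass.rep).Perm
        (s.rep :: (Finsupp.toMultiset m).toList.map SimpleClass.rep) := by
      rw [← List.map_cons]
      refine List.Perm.map _ (Multiset.coe_eq_coe.1 ?_)
      rw [Multiset.coe_toList, ← Multiset.cons_coe, Multiset.coe_toList, map_add,
        Finsupp.toMultiset_single, one_smul, Multiset.singleton_add]
    obtain ⟨e⟩ := nonempty_listTensor_iso_of_perm hperm
    rw [monomialTensor, finrank_hom_congr k (Iso.refl _) e]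
    rfl
  exact LinearMap.congr_fun h P

lemma unitMultiplicity_X_pow (s : SimpleClass C) (n : ℕ) :
    unitMultiplicity k C (MvPolynomial.X s ^ n) =
      Module.finrank k (𝟙_ C ⟶ tpow s.rep n) := by
  rw [MvPolynomial.X_pow_eq_monomial, unitMultiplicity_monomial, monomialTensor,
    Finsupp.toMultiset_single, Multiset.nsmul_singleton]
  have h : (Multiset.replicate n s).toList = List.replicate n s := by
    rw [← List.perm_replicate, ← Multiset.coe_eq_coe, Multiset.coe_toList,
      Multiset.coe_replicate]
  rw [h, List.map_replicate, listTensor_replicate]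

lemma globalDim_eq_dimEval [Fintype (SimpleClass C)] :
    globalDim k C = dimEval k C (regularElement k C) := by
  rw [globalDim, finsum_eq_sum_of_fintype, regularElement, map_sum]
  simp [dimEval, sq]

/-- The multiplicity of the unit object in the `p`-th power of the regular element is the
`(p - 1)`-st power of the global dimension. It is also `1`: in characteristic `p` only the powers
`X^{⊗ p}` of the simple objects contribute, and of these only the one of the unit object. -/
lemma globalDim_pow_eq_one (p : ℕ) [Fact p.Prime] [CharP k p]
    (hfull : (frobeniusFunctor p C).Full)
    (htype : ∀ X : C, boxSub k p C (vecSub k p) ((frobeniusFunctor p C).obj X)) :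
    globalDim k C ^ (p - 1) = 1 := by
  have := finite_simpleClass k C
  have := Fintype.ofFinite (SimpleClass C)
  have : Simple (𝟙_ C) := IsFusionCategory.simple_unit k
  have hfin : FiniteDimensional k (𝟙_ C ⟶ 𝟙_ C) := IsFusionCategory.finite_hom _ _
  have hp : p - 1 + 1 = p := Nat.sub_add_cancel (Fact.out : p.Prime).one_le
  -- the power is turned into `unitMultiplicity (ω ^ p)` and expanded in characteristic `p`
  rw [globalDim_eq_dimEval, ← map_pow, ← unitMultiplicity_regularElement_mul, ← pow_succ', hp,
    regularElement, sum_pow_char, map_sum]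
  obtain ⟨e⟩ := (simpleClass_eq_iff (𝟙_ C) _).1 rfl
  rw [Finset.sum_eq_single (simpleClass (𝟙_ C))]
  · rw [smul_pow, map_smul, unitMultiplicity_X_pow, ← catDim_congr k e, catDim_unit,
      finrank_hom_congr k (Iso.refl _) ((tpowIso e p).symm ≪≫ tpowUnitIso C p),
      finrank_endomorphism_simple_eq_one k (𝟙_ C)]
    simp
  · intro s _ hs
    rw [smul_pow, map_smul, unitMultiplicity_X_pow,
      finrank_hom_unit_tpow k p hfull htype, smul_zero]
    intro f
    by_contra hf
    have := isIso_of_hom_simple hf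
    exact hs ((simpleClass_eq_iff (𝟙_ C) s).2 ⟨asIso f⟩).symm
  · simp

end Counting

end SymFusion

end

theorem lemma4p1 {k : Type w} [Field k] [IsAlgClosed k] (p : ℕ) [Fact p.Prime] [CharP k p]
    {C : Type u} [Category.{v} C] [Abelian C] [Linear k C] [MonoidalCategory C]
    [SymmetricCategory C] [MonoidalPreadditive C] [MonoidalLinear k C] [RigidCategory C]
    [SymFusion.IsFusionCategory k C]
    (hinj : SymFusion.IsFrobeniusInjective p C)
    (htype : SymFusion.IsOfFrobeniusType k p C (SymFusion.vecSub k p)) :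
    SymFusion.IsNondegenerate k C := by
  intro h
  have h' := SymFusion.globalDim_pow_eq_one k C p hinj.1 htype.1.2
  rw [h, zero_pow (Nat.sub_ne_zero_of_lt (Fact.out : p.Prime).one_lt)] at h'
  exact zero_ne_one h'
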